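/- Let $\Bbbk$ be a field of arbitrary characteristic. A (left) Leibniz algebra is a linear space $L$ over $\Bbbk$ (of any dimension) with a bilinear operation $[\cdot\,\cdot]$ such that $[x[yz]]=[[xy]z]+[y[xz]]$ for all $x,y,z\in L$. An associative dialgebra is a linear space with two bilinear operations $\dashv,\vdash$ such that $(x\dashv y)\vdash z=(x\vdash y)\vdash z$, $x\dashv(y\vdash z)=x\dashv(y\dashv z)$, $(x\dashv y)\dashv z=x\dashv(y\dashv z)$, $(x\vdash y)\dashv z=x\vdash(y\dashv z)$ and $(x\vdash y)\vdash z=x\vdash(y\vdash z)$. The universal enveloping associative dialgebra $U(L)$ of a Leibniz algebra $L$ is the quotient of the free associative dialgebra $F(L)$ generated by the linear space $L$ by the (two-sided) ideal generated by all elements $a\vdash b-b\dashv a-[ab]$, $a,b\in L$. Let $L^{\mathrm{alg}}=L/\operatorname{Span}\{[ab]+[ba]\mid a,b\in L\}$, with the induced bracket; this is a Lie algebra, in the sense that its bracket satisfies $[xy]+[yx]=0$ and the Jacobi identity. Let $U(L^{\mathrm{alg}})$ be its universal enveloping associative algebra, the quotient of the tensor algebra of $L^{\mathrm{alg}}$ by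 the ideal generated by all $x\otimes y-y\otimes x-[xy]$, $x,y\in L^{\mathrm{alg}}$. Then for every Leibniz algebra $L$ the linear spaces $U(L)$ and $L\otimes_{\Bbbk} U(L^{\mathrm{alg}})$ are isomorphic. -/

import Mathlib

open scoped TensorProduct

namespace LeibnizPBW

universe u v

section Quotients

variable {k : Type u} [Field k] {A : Type v} [AddCommGroup A] [Module k A]

/-- The bilinear operation induced on `A ⧸ I` by a bilinear operation `f` on `A` for which `I` is a
two-sided ideal. -/
def quotBilin (I : Submodule k A) (f : A →ₗ[k] A →ₗ[k] A)
    (hl : ∀ a b, a ∈ I → f a b ∈ I) (hr : ∀ a b, b ∈ I → f a b ∈ I) :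
    (A ⧸ I) →ₗ[k] (A ⧸ I) →ₗ[k] (A ⧸ I) :=
  I.liftQ
    { toFun := fun a => I.mapQ I (f a) (fun b hb => hr a b hb)
      map_add' := by
        intro a b
        apply Submodule.linearMap_qext
        ext c
        simp
      map_smul' := by
        intro r a
        apply Submodule.linearMap_qext
        ext c
        simp }
    (by
      intro a ha
      rw [LinearMap.mem_ker]
      apply Submodule.linearMap_qext
      ext b
      simpa using hl a b ha)

@[simp]
theorem quotBilin_mk (I : Submodule k A) (f : A →ₗ[k] A →ₗ[k] A)
    (hl : ∀ a b, a ∈ I → f a b ∈ I) (hr : ∀ a b, b ∈ I → f a b ∈ I) (a b : A) :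
    quotBilin I f hl hr (I.mkQ a) (I.mkQ b) = I.mkQ (f a b) := rfl

end Quotients

/-! ### Dialgebras -/

/-- A dialgebra over `k`: a linear space with two bilinear operations,
`ldash a b`, written `a ⊣ b`, and `rdash a b`, written `a ⊢ b`. -/
class Dialgebra (k : Type u) (A : Type v) [Field k] [AddCommGroup A] [Module k A] where
  /-- `ldash a b` is `a ⊣ b` -/
  ldash : A →ₗ[k] A →ₗ[k] A
  /-- `rdash a b` is `a ⊢ b` -/
  rdash : A →ₗ[k] A →ₗ[k] A

section Dialgebra

variable (k : Type u) [Field k]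

/-- `a ⊣ b` -/
def ld {A : Type v} [AddCommGroup A] [Module k A] [Dialgebra k A] (a b : A) : A :=
  Dialgebra.ldash (k := k) a b

/-- `a ⊢ b` -/
def rd {A : Type v} [AddCommGroup A] [Module k A] [Dialgebra k A] (a b : A) : A :=
  Dialgebra.rdash (k := k) a b

/-- Associative dialgebras. -/
class IsAssocDialgebra (A : Type v) [AddCommGroup A] [Module k A] [Dialgebra k A] : Prop where
  bar_right : ∀ x y z : A, rd k (ld k x y) z = rd k (rd k x y) z
  bar_left : ∀ x y z : A, ld k x (rd k y z) = ld k x (ld k y z)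
  assoc_ll : ∀ x y z : A, ld k (ld k x y) z = ld k x (ld k y z)
  assoc_rl : ∀ x y z : A, ld k (rd k x y) z = rd k x (ld k y z)
  assoc_rr : ∀ x y z : A, rd k (rd k x y) z = rd k x (rd k y z)

variable {A : Type v} [AddCommGroup A] [Module k A] [Dialgebra k A]

variable (A) in
/-- Two-sided ideals of a dialgebra, with respect to both operations. -/
structure DiIdeal extends Submodule k A where
  ld_mem_left : ∀ a b, a ∈ toSubmodule → ld k a b ∈ toSubmodule
  ld_mem_right : ∀ a b, b ∈ toSubmodule → ld k a b ∈ toSubmodule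
  rd_mem_left : ∀ a b, a ∈ toSubmodule → rd k a b ∈ toSubmodule
  rd_mem_right : ∀ a b, b ∈ toSubmodule → rd k a b ∈ toSubmodule

/-- The ideal generated by `S`: the intersection of all ideals that contain `S`. -/
def idealSpan (S : Set A) : DiIdeal k A where
  toSubmodule := sInf {I | ∃ J : DiIdeal k A, J.toSubmodule = I ∧ S ⊆ (I : Set A)}
  ld_mem_left a b h := by
    rw [Submodule.mem_sInf] at h ⊢
    rintro _ ⟨J, rfl, hJ⟩
    exact J.ld_mem_left a b (h _ ⟨J, rfl, hJ⟩)
  ld_mem_right a b h := by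
    rw [Submodule.mem_sInf] at h ⊢
    rintro _ ⟨J, rfl, hJ⟩
    exact J.ld_mem_right a b (h _ ⟨J, rfl, hJ⟩)
  rd_mem_left a b h := by
    rw [Submodule.mem_sInf] at h ⊢
    rintro _ ⟨J, rfl, hJ⟩
    exact J.rd_mem_left a b (h _ ⟨J, rfl, hJ⟩)
  rd_mem_right a b h := by
    rw [Submodule.mem_sInf] at h ⊢
    rintro _ ⟨J, rfl, hJ⟩
    exact J.rd_mem_right a b (h _ ⟨J, rfl, hJ⟩)

theorem subset_idealSpan (S : Set A) : S ⊆ ((idealSpan k S).toSubmodule : Set A) := by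
  intro a ha
  refine Submodule.mem_sInf.2 ?_
  rintro _ ⟨J, rfl, hJ⟩
  exact hJ ha

/-- The quotient dialgebra. -/
instance quotientDialgebra (I : DiIdeal k A) : Dialgebra k (A ⧸ I.toSubmodule) where
  ldash := quotBilin I.toSubmodule Dialgebra.ldash I.ld_mem_left I.ld_mem_right
  rdash := quotBilin I.toSubmodule Dialgebra.rdash I.rd_mem_left I.rd_mem_right

end Dialgebra

/-! ### Free dialgebras -/

/-- Nonassociative monomials in generators from `V`, in the two operations `⊣` and `⊢`. -/
inductive DiMonomial (V : Type v) : Type v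
  | gen : V → DiMonomial V
  | ldash : DiMonomial V → DiMonomial V → DiMonomial V
  | rdash : DiMonomial V → DiMonomial V → DiMonomial V

section Free

variable (k : Type u) [Field k] (V : Type v)

/-- The free (nonassociative) dialgebra generated by the set `V`: linear combinations of
nonassociative monomials. -/
abbrev FreeDialgebra : Type (max u v) := DiMonomial V →₀ k

/-- The operations extend the ones on monomials bilinearly. -/
noncomputable instance : Dialgebra k (FreeDialgebra k V) where
  ldash := Finsupp.linearCombination k fun s => Finsupp.lmapDomain k k (DiMonomial.ldash s)
  rdash := Finsupp.linearCombination k fun s => Finsupp.lmapDomain k k (DiMonomial.rdash s)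

variable {V} in
/-- The generator of the free dialgebra given by `v`. -/
noncomputable def FreeDialgebra.gen (v : V) : FreeDialgebra k V :=
  Finsupp.single (DiMonomial.gen v) 1

variable [AddCommGroup V] [Module k V]

/-- The relations between the free dialgebra generated by the set `V` and the free associative
dialgebra generated by the linear space `V`. -/
inductive FreeAssocRel : FreeDialgebra k V → Prop
  | add (u v : V) : FreeAssocRel
      (FreeDialgebra.gen k (u + v) - (FreeDialgebra.gen k u + FreeDialgebra.gen k v))
  | smul (r : k) (v : V) : FreeAssocRel
      (FreeDialgebra.gen k (r • v) - r • FreeDialgebra.gen k v)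
  | bar_right (x y z : FreeDialgebra k V) : FreeAssocRel
      (rd k (ld k x y) z - rd k (rd k x y) z)
  | bar_left (x y z : FreeDialgebra k V) : FreeAssocRel
      (ld k x (rd k y z) - ld k x (ld k y z))
  | assoc_ll (x y z : FreeDialgebra k V) : FreeAssocRel
      (ld k (ld k x y) z - ld k x (ld k y z))
  | assoc_rl (x y z : FreeDialgebra k V) : FreeAssocRel
      (ld k (rd k x y) z - rd k x (ld k y z))
  | assoc_rr (x y z : FreeDialgebra k V) : FreeAssocRel
      (rd k (rd k x y) z - rd k x (rd k y z))

/-- The free associative dialgebra `F(V)` generated by the linear space `V`. -/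
abbrev FreeAssocDialgebra : Type (max u v) :=
  FreeDialgebra k V ⧸ (idealSpan k {x | FreeAssocRel k V x}).toSubmodule

variable {V} in
/-- The canonical map `V → F(V)`. -/
noncomputable def FreeAssocDialgebra.of (v : V) : FreeAssocDialgebra k V :=
  Submodule.Quotient.mk (FreeDialgebra.gen k v)

/-- `F(V)` is an associative dialgebra. -/
instance : IsAssocDialgebra k (FreeAssocDialgebra k V) where
  bar_right := by
    rintro ⟨x⟩ ⟨y⟩ ⟨z⟩
    exact (Submodule.Quotient.eq _).2 (subset_idealSpan k _ (FreeAssocRel.bar_right x y z))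
  bar_left := by
    rintro ⟨x⟩ ⟨y⟩ ⟨z⟩
    exact (Submodule.Quotient.eq _).2 (subset_idealSpan k _ (FreeAssocRel.bar_left x y z))
  assoc_ll := by
    rintro ⟨x⟩ ⟨y⟩ ⟨z⟩
    exact (Submodule.Quotient.eq _).2 (subset_idealSpan k _ (FreeAssocRel.assoc_ll x y z))
  assoc_rl := by
    rintro ⟨x⟩ ⟨y⟩ ⟨z⟩
    exact (Submodule.Quotient.eq _).2 (subset_idealSpan k _ (FreeAssocRel.assoc_rl x y z))
  assoc_rr := by
    rintro ⟨x⟩ ⟨y⟩ ⟨z⟩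
    exact (Submodule.Quotient.eq _).2 (subset_idealSpan k _ (FreeAssocRel.assoc_rr x y z))

end Free

/-! ### Leibniz algebras -/

/-- A (left) Leibniz algebra over `k`: a linear space with a bilinear operation `[xy]` that satisfies
`[x[yz]] = [[xy]z] + [y[xz]]`. -/
class LeibnizAlgebra (k : Type u) (L : Type v) [Field k] [AddCommGroup L] [Module k L] where
  /-- the operation `[xy]` -/
  br : L →ₗ[k] L →ₗ[k] L
  leibniz : ∀ x y z : L, br x (br y z) = br (br x y) z + br y (br x z)

section Leibniz

variable (k : Type u) [Field k] (L : Type v) [AddCommGroup L] [Module k L] [LeibnizAlgebra k L]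

open LeibnizAlgebra (br)

/-- The universal enveloping associative dialgebra `U(L)`: the quotient of `F(L)` by the ideal
generated by the elements `a ⊢ b - b ⊣ a - [ab]`. -/
abbrev EnvelopingDialgebra : Type (max u v) :=
  FreeAssocDialgebra k L ⧸ (idealSpan k {x : FreeAssocDialgebra k L | ∃ a b : L,
    x = rd k (FreeAssocDialgebra.of k a) (FreeAssocDialgebra.of k b)
      - ld k (FreeAssocDialgebra.of k b) (FreeAssocDialgebra.of k a)
      - FreeAssocDialgebra.of k (br (k := k) a b)}).toSubmodule

/-- The span of all `[ab] + [ba]`. -/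
def symSpan : Submodule k L :=
  Submodule.span k {x | ∃ a b : L, x = br (k := k) a b + br (k := k) b a}

theorem br_mem_symSpan_left (a b : L) (h : a ∈ symSpan k L) : br (k := k) a b ∈ symSpan k L := by
  suffices br (k := k) a b = 0 by rw [this]; exact zero_mem _
  induction h using Submodule.span_induction with
  | mem x hx =>
    obtain ⟨c, d, rfl⟩ := hx
    rw [map_add, LinearMap.add_apply]
    have h1 := LeibnizAlgebra.leibniz (k := k) c d b
    rw [LeibnizAlgebra.leibniz (k := k) d c b, ← add_assoc] at h1
    exact right_eq_add.1 h1
  | zero => simp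
  | add x y _ _ hx hy => simp [hx, hy]
  | smul r x _ hx => simp [hx]

theorem br_mem_symSpan_right (a b : L) (h : b ∈ symSpan k L) : br (k := k) a b ∈ symSpan k L := by
  induction h using Submodule.span_induction with
  | mem x hx =>
    obtain ⟨c, d, rfl⟩ := hx
    have e : br (k := k) a (br (k := k) c d + br (k := k) d c)
        = (br (k := k) (br (k := k) a c) d + br (k := k) d (br (k := k) a c))
          + (br (k := k) (br (k := k) a d) c + br (k := k) c (br (k := k) a d)) := by
      rw [map_add, LeibnizAlgebra.leibniz a c d, LeibnizAlgebra.leibniz a d c]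
      abel
    rw [e]
    exact add_mem (Submodule.subset_span ⟨_, _, rfl⟩) (Submodule.subset_span ⟨_, _, rfl⟩)
  | zero => simp
  | add x y _ _ hx hy => rw [map_add]; exact add_mem hx hy
  | smul r x _ hx => rw [map_smul]; exact Submodule.smul_mem _ _ hx

/-- `L^alg`, the quotient of `L` by the span of all `[ab] + [ba]`. -/
abbrev LAlg : Type v := L ⧸ symSpan k L

/-- The bracket of `L^alg`. -/
def lalgBr : LAlg k L →ₗ[k] LAlg k L →ₗ[k] LAlg k L :=
  quotBilin (symSpan k L) br (br_mem_symSpan_left k L) (br_mem_symSpan_right k L)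

/-- `L^alg` is anticommutative. -/
theorem lalgBr_anticomm (x y : LAlg k L) : lalgBr k L x y + lalgBr k L y x = 0 := by
  obtain ⟨a, rfl⟩ := (symSpan k L).mkQ_surjective x
  obtain ⟨b, rfl⟩ := (symSpan k L).mkQ_surjective y
  exact (Submodule.Quotient.mk_eq_zero _).2 (Submodule.subset_span ⟨a, b, rfl⟩)

/-- `L^alg` satisfies the Jacobi identity. -/
theorem lalgBr_jacobi (x y z : LAlg k L) :
    lalgBr k L x (lalgBr k L y z)
      = lalgBr k L (lalgBr k L x y) z + lalgBr k L y (lalgBr k L x z) := by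
  obtain ⟨a, rfl⟩ := (symSpan k L).mkQ_surjective x
  obtain ⟨b, rfl⟩ := (symSpan k L).mkQ_surjective y
  obtain ⟨c, rfl⟩ := (symSpan k L).mkQ_surjective z
  exact congrArg (symSpan k L).mkQ (LeibnizAlgebra.leibniz a b c)

end Leibniz

/-! ### Universal enveloping associative algebras -/

section Enveloping

variable (k : Type u) [Field k] {g : Type v} [AddCommGroup g] [Module k g]

/-- The relations `xy = [xy] + yx` in the tensor algebra. -/
inductive EnvelopingRel (f : g →ₗ[k] g →ₗ[k] g) : TensorAlgebra k g → TensorAlgebra k g → Prop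
  | br (x y : g) : EnvelopingRel f
      (TensorAlgebra.ι k (f x y) + TensorAlgebra.ι k y * TensorAlgebra.ι k x)
      (TensorAlgebra.ι k x * TensorAlgebra.ι k y)

/-- The universal enveloping associative algebra of the linear space `g` with the bracket `f`:
the tensor algebra modulo the relations `xy - yx = [xy]`.  Mathlib's `UniversalEnvelopingAlgebra`
is this algebra for a `LieAlgebra`, where `[xx] = 0`; in characteristic `2` the identity
`[xy] + [yx] = 0`, which is all that holds in `L^alg`, is weaker. -/
abbrev EnvelopingAlgebra (f : g →ₗ[k] g →ₗ[k] g) : Type (max u v) := RingQuot (EnvelopingRel k f)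

end Enveloping

attribute [local instance 100] LieRing.ofAssociativeRing in
/-- For a Lie algebra in the sense of Mathlib, this is Mathlib's universal enveloping algebra. -/
theorem envelopingAlgebra_lie (k : Type u) [Field k] (g : Type v) [LieRing g] [LieAlgebra k g] :
    Nonempty (EnvelopingAlgebra k (LieModule.toEnd k g g : g →ₗ[k] g →ₗ[k] g)
      ≃ₐ[k] UniversalEnvelopingAlgebra k g) := by
  let F : EnvelopingAlgebra k (LieModule.toEnd k g g : g →ₗ[k] g →ₗ[k] g)
      →ₐ[k] UniversalEnvelopingAlgebra k g :=
    RingQuot.liftAlgHom k ⟨TensorAlgebra.lift k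
      ((UniversalEnvelopingAlgebra.ι k : g →ₗ⁅k⁆ UniversalEnvelopingAlgebra k g) :
        g →ₗ[k] UniversalEnvelopingAlgebra k g), by
        rintro _ _ ⟨x, y⟩
        simp [LieRing.of_associative_ring_bracket]⟩
  let G : UniversalEnvelopingAlgebra k g
      →ₐ[k] EnvelopingAlgebra k (LieModule.toEnd k g g : g →ₗ[k] g →ₗ[k] g) :=
    UniversalEnvelopingAlgebra.lift k
      { (RingQuot.mkAlgHom k (EnvelopingRel k _)).toLinearMap.comp (TensorAlgebra.ι k) with
        map_lie' := by
          intro x y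
          have h := RingQuot.mkAlgHom_rel k
            (EnvelopingRel.br (f := (LieModule.toEnd k g g : g →ₗ[k] g →ₗ[k] g)) x y)
          rw [map_add, map_mul, map_mul] at h
          exact eq_sub_of_add_eq h }
  refine ⟨AlgEquiv.ofAlgHom F G ?_ ?_⟩
  · ext x
    simp only [F, G, LieHom.coe_comp, Function.comp_apply, AlgHom.coe_toLieHom,
      AlgHom.coe_comp, UniversalEnvelopingAlgebra.lift_ι_apply]
    exact (RingQuot.liftAlgHom_mkAlgHom_apply _ _ _ _).trans (TensorAlgebra.lift_ι_apply _ _)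
  · ext x
    simp [F, G]
    rfl

/-- If `2 ≠ 0` in `k` then `L^alg` is a Lie algebra in the sense of Mathlib. -/
theorem lalgBr_self (k : Type u) [Field k] (h2 : (2 : k) ≠ 0) (L : Type v) [AddCommGroup L]
    [Module k L] [LeibnizAlgebra k L] (x : LAlg k L) : lalgBr k L x x = 0 := by
  have h := lalgBr_anticomm k L x x
  rw [← two_smul k] at h
  exact (smul_eq_zero.1 h).resolve_left h2

end LeibnizPBW

namespace LeibnizPBW

universe u v w

/-! ### Dialgebras: quotients, homomorphisms and universal properties -/

section Dialgebra

variable (k : Type u) [Field k] {A : Type v} [AddCommGroup A] [Module k A] [Dialgebra k A]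

/-! Write U for the algebra U(L^alg). If M is a U-bimodule and π : M → U is a homomorphism of
bimodules, then x ⊢ y = π(x) y and x ⊣ y = x π(y) make M an associative dialgebra. Take M = L ⊗ U,
with right multiplication on the second factor, the left action a(b ⊗ u) = [ab] ⊗ u + b ⊗ au, and
π(b ⊗ u) = bu. The left action is well defined because of the Leibniz identity (`leftAct_mul`). In M
one has (a ⊗ 1) ⊢ (b ⊗ 1) = [ab] ⊗ 1 + (b ⊗ 1) ⊣ (a ⊗ 1), so the universal property gives a
homomorphism U(L) → M with b ↦ b ⊗ 1.

Conversely, x ↦ x ⊣ a makes U(L) a right U-module, since x ⊣ (a ⊢ b) = x ⊣ (a ⊣ b), and b ⊗ u ↦ b ·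
u maps M back to U(L). The two maps are inverse: both respect the right action, and multiplication
by an element y of U(L) on its bar side depends only on the image of y in U
(`rightAct_tensorMul_toTensor`, `ofTensor_leftMul_tensorMul_toTensor`). No basis or normal form is
used, so the characteristic and the dimension play no role. -/

theorem ld_add (a b c : A) : ld k a (b + c) = ld k a b + ld k a c := map_add _ _ _

theorem ld_smul (r : k) (a b : A) : ld k a (r • b) = r • ld k a b := map_smul _ _ _

theorem rd_add (a b c : A) : rd k a (b + c) = rd k a b + rd k a c := map_add _ _ _

theorem rd_smul (r : k) (a b : A) : rd k a (r • b) = r • rd k a b := map_smul _ _ _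

theorem rd_zero (a : A) : rd k a 0 = 0 := map_zero _

theorem add_rd (a b c : A) : rd k (a + b) c = rd k a c + rd k b c :=
  LinearMap.map_add₂ _ _ _ _

theorem smul_rd (r : k) (a b : A) : rd k (r • a) b = r • rd k a b :=
  LinearMap.map_smul₂ _ _ _ _

instance quotient_isAssocDialgebra (I : DiIdeal k A) [IsAssocDialgebra k A] :
    IsAssocDialgebra k (A ⧸ I.toSubmodule) where
  bar_right := by
    rintro ⟨x⟩ ⟨y⟩ ⟨z⟩
    exact congrArg I.toSubmodule.mkQ (IsAssocDialgebra.bar_right x y z)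
  bar_left := by
    rintro ⟨x⟩ ⟨y⟩ ⟨z⟩
    exact congrArg I.toSubmodule.mkQ (IsAssocDialgebra.bar_left x y z)
  assoc_ll := by
    rintro ⟨x⟩ ⟨y⟩ ⟨z⟩
    exact congrArg I.toSubmodule.mkQ (IsAssocDialgebra.assoc_ll x y z)
  assoc_rl := by
    rintro ⟨x⟩ ⟨y⟩ ⟨z⟩
    exact congrArg I.toSubmodule.mkQ (IsAssocDialgebra.assoc_rl x y z)
  assoc_rr := by
    rintro ⟨x⟩ ⟨y⟩ ⟨z⟩
    exact congrArg I.toSubmodule.mkQ (IsAssocDialgebra.assoc_rr x y z)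

variable {B : Type w} [AddCommGroup B] [Module k B] [Dialgebra k B]

/-- A linear map that preserves both operations. -/
structure IsDiHom (f : A →ₗ[k] B) : Prop where
  map_ld : ∀ a b, f (ld k a b) = ld k (f a) (f b)
  map_rd : ∀ a b, f (rd k a b) = rd k (f a) (f b)

variable {k}

/-- The kernel of a homomorphism of dialgebras. -/
def IsDiHom.ker {f : A →ₗ[k] B} (hf : IsDiHom k f) : DiIdeal k A where
  toSubmodule := LinearMap.ker f
  ld_mem_left a b h := by
    rw [LinearMap.mem_ker] at h ⊢
    rw [hf.map_ld, h]
    exact LinearMap.map_zero₂ _ _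
  ld_mem_right a b h := by
    rw [LinearMap.mem_ker] at h ⊢
    rw [hf.map_ld, h]
    exact map_zero _
  rd_mem_left a b h := by
    rw [LinearMap.mem_ker] at h ⊢
    rw [hf.map_rd, h]
    exact LinearMap.map_zero₂ _ _
  rd_mem_right a b h := by
    rw [LinearMap.mem_ker] at h ⊢
    rw [hf.map_rd, h]
    exact map_zero _

/-- The kernel is one of the ideals whose intersection defines the generated ideal. -/
theorem IsDiHom.idealSpan_le_ker {f : A →ₗ[k] B} (hf : IsDiHom k f) {S : Set A}
    (h : ∀ x ∈ S, f x = 0) : (idealSpan k S).toSubmodule ≤ LinearMap.ker f :=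
  sInf_le ⟨hf.ker, rfl, h⟩

theorem IsDiHom.liftQ {f : A →ₗ[k] B} (hf : IsDiHom k f) (I : DiIdeal k A)
    (h : I.toSubmodule ≤ LinearMap.ker f) : IsDiHom k (I.toSubmodule.liftQ f h) where
  map_ld := by
    rintro ⟨a⟩ ⟨b⟩
    exact hf.map_ld a b
  map_rd := by
    rintro ⟨a⟩ ⟨b⟩
    exact hf.map_rd a b

end Dialgebra

section Free

variable {k : Type u} [Field k] {V : Type v}
variable {B : Type w} [AddCommGroup B] [Module k B] [Dialgebra k B]

variable (k) in
/-- The value of a monomial in a dialgebra. -/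
def DiMonomial.eval (f : V → B) : DiMonomial V → B
  | .gen v => f v
  | .ldash s t => ld k (s.eval f) (t.eval f)
  | .rdash s t => rd k (s.eval f) (t.eval f)

theorem FreeDialgebra.ld_single (s t : DiMonomial V) (a b : k) :
    ld k (Finsupp.single s a : FreeDialgebra k V) (Finsupp.single t b)
      = Finsupp.single (.ldash s t) (a * b) := by
  change (Finsupp.linearCombination k fun s => Finsupp.lmapDomain k k (DiMonomial.ldash s))
    (Finsupp.single s a) (Finsupp.single t b) = _
  simp [Finsupp.linearCombination_single, Finsupp.mapDomain_single]

theorem FreeDialgebra.rd_single (s t : DiMonomial V) (a b : k) :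
    rd k (Finsupp.single s a : FreeDialgebra k V) (Finsupp.single t b)
      = Finsupp.single (.rdash s t) (a * b) := by
  change (Finsupp.linearCombination k fun s => Finsupp.lmapDomain k k (DiMonomial.rdash s))
    (Finsupp.single s a) (Finsupp.single t b) = _
  simp [Finsupp.linearCombination_single, Finsupp.mapDomain_single]

/-- The homomorphism from the free dialgebra given by the values on generators. -/
noncomputable def FreeDialgebra.lift (f : V → B) : FreeDialgebra k V →ₗ[k] B :=
  Finsupp.linearCombination k (DiMonomial.eval k f)

theorem FreeDialgebra.lift_gen (f : V → B) (v : V) :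
    FreeDialgebra.lift f (FreeDialgebra.gen k v) = f v := by
  simp [FreeDialgebra.lift, FreeDialgebra.gen, DiMonomial.eval]

theorem FreeDialgebra.isDiHom_lift (f : V → B) : IsDiHom k (FreeDialgebra.lift (k := k) f) where
  map_ld a b := by
    -- Both sides are bilinear in `a` and `b`, so pairs of monomials suffice.
    have h : (Dialgebra.ldash (k := k) (A := FreeDialgebra k V)).compr₂ (FreeDialgebra.lift f)
        = (Dialgebra.ldash (k := k)).compl₁₂ (FreeDialgebra.lift f) (FreeDialgebra.lift f) := by
      ext s t
      change FreeDialgebra.lift f (ld k (Finsupp.single s 1) (Finsupp.single t 1))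
        = ld k (FreeDialgebra.lift f (Finsupp.single s 1))
          (FreeDialgebra.lift f (Finsupp.single t 1))
      simp [FreeDialgebra.ld_single, FreeDialgebra.lift, DiMonomial.eval]
    exact LinearMap.congr_fun₂ h a b
  map_rd a b := by
    have h : (Dialgebra.rdash (k := k) (A := FreeDialgebra k V)).compr₂ (FreeDialgebra.lift f)
        = (Dialgebra.rdash (k := k)).compl₁₂ (FreeDialgebra.lift f) (FreeDialgebra.lift f) := by
      ext s t
      change FreeDialgebra.lift f (rd k (Finsupp.single s 1) (Finsupp.single t 1))
        = rd k (FreeDialgebra.lift f (Finsupp.single s 1))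
          (FreeDialgebra.lift f (Finsupp.single t 1))
      simp [FreeDialgebra.rd_single, FreeDialgebra.lift, DiMonomial.eval]
    exact LinearMap.congr_fun₂ h a b

theorem FreeDialgebra.induction {p : FreeDialgebra k V → Prop}
    (gen : ∀ v, p (FreeDialgebra.gen k v))
    (ldash : ∀ a b, p a → p b → p (ld k a b)) (rdash : ∀ a b, p a → p b → p (rd k a b))
    (add : ∀ a b, p a → p b → p (a + b)) (smul : ∀ (r : k) a, p a → p (r • a)) (zero : p 0)
    (a : FreeDialgebra k V) : p a := by
  have mon : ∀ s : DiMonomial V, p (Finsupp.single s 1) := by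
    intro s
    induction s with
    | gen v => exact gen v
    | ldash s t hs ht => simpa [FreeDialgebra.ld_single] using ldash _ _ hs ht
    | rdash s t hs ht => simpa [FreeDialgebra.rd_single] using rdash _ _ hs ht
  induction a using Finsupp.induction_linear with
  | zero => exact zero
  | add f g hf hg => exact add f g hf hg
  | single s r => simpa using smul r _ (mon s)

variable [AddCommGroup V] [Module k V]

theorem FreeAssocDialgebra.relations_le_ker_lift [IsAssocDialgebra k B] (f : V →ₗ[k] B) :
    (idealSpan k {x | FreeAssocRel k V x}).toSubmodule
      ≤ LinearMap.ker (FreeDialgebra.lift (k := k) f) := by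
  have hf := FreeDialgebra.isDiHom_lift (k := k) f
  refine hf.idealSpan_le_ker ?_
  rintro _ (⟨u, v⟩ | ⟨r, v⟩ | ⟨x, y, z⟩ | ⟨x, y, z⟩ | ⟨x, y, z⟩ | ⟨x, y, z⟩ | ⟨x, y, z⟩)
  · simp [FreeDialgebra.lift_gen]
  · simp [FreeDialgebra.lift_gen]
  · rw [map_sub, sub_eq_zero]
    simp only [hf.map_ld, hf.map_rd]
    exact IsAssocDialgebra.bar_right _ _ _
  · rw [map_sub, sub_eq_zero]
    simp only [hf.map_ld, hf.map_rd]
    exact IsAssocDialgebra.bar_left _ _ _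
  · rw [map_sub, sub_eq_zero]
    simp only [hf.map_ld]
    exact IsAssocDialgebra.assoc_ll _ _ _
  · rw [map_sub, sub_eq_zero]
    simp only [hf.map_ld, hf.map_rd]
    exact IsAssocDialgebra.assoc_rl _ _ _
  · rw [map_sub, sub_eq_zero]
    simp only [hf.map_rd]
    exact IsAssocDialgebra.assoc_rr _ _ _

/-- The universal property of the free associative dialgebra of a linear space. -/
noncomputable def FreeAssocDialgebra.lift [IsAssocDialgebra k B] (f : V →ₗ[k] B) :
    FreeAssocDialgebra k V →ₗ[k] B :=
  Submodule.liftQ _ (FreeDialgebra.lift f) (FreeAssocDialgebra.relations_le_ker_lift f)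

theorem FreeAssocDialgebra.isDiHom_lift [IsAssocDialgebra k B] (f : V →ₗ[k] B) :
    IsDiHom k (FreeAssocDialgebra.lift f) :=
  (FreeDialgebra.isDiHom_lift f).liftQ _ _

theorem FreeAssocDialgebra.lift_of [IsAssocDialgebra k B] (f : V →ₗ[k] B) (v : V) :
    FreeAssocDialgebra.lift f (FreeAssocDialgebra.of k v) = f v :=
  FreeDialgebra.lift_gen f v

variable (k V) in
/-- The canonical map `V → F(V)`, as a linear map. -/
noncomputable def FreeAssocDialgebra.ofₗ : V →ₗ[k] FreeAssocDialgebra k V where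
  toFun := FreeAssocDialgebra.of k
  map_add' u v := (Submodule.Quotient.eq _).2 (subset_idealSpan k _ (FreeAssocRel.add u v))
  map_smul' r v := (Submodule.Quotient.eq _).2 (subset_idealSpan k _ (FreeAssocRel.smul r v))

end Free

/-! ### The universal enveloping dialgebra -/

namespace EnvelopingDialgebra

variable {k : Type u} [Field k] {L : Type v} [AddCommGroup L] [Module k L] [LeibnizAlgebra k L]

open LeibnizAlgebra (br)

variable (k L) in
/-- The canonical map `L → U(L)`. -/
noncomputable def ι : L →ₗ[k] EnvelopingDialgebra k L :=
  (Submodule.mkQ _).comp (FreeAssocDialgebra.ofₗ k L)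

theorem rd_ι_ι (a b : L) :
    rd k (ι k L a) (ι k L b) = ld k (ι k L b) (ι k L a) + ι k L (br (k := k) a b) := by
  have h := (Submodule.Quotient.mk_eq_zero _).2 (subset_idealSpan k
    {x : FreeAssocDialgebra k L | ∃ a b : L,
      x = rd k (FreeAssocDialgebra.of k a) (FreeAssocDialgebra.of k b)
        - ld k (FreeAssocDialgebra.of k b) (FreeAssocDialgebra.of k a)
        - FreeAssocDialgebra.of k (br (k := k) a b)} ⟨a, b, rfl⟩)
  exact sub_eq_iff_eq_add'.1 (sub_eq_zero.1 h)

theorem induction {p : EnvelopingDialgebra k L → Prop}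
    (gen : ∀ v, p (ι k L v))
    (ldash : ∀ a b, p a → p b → p (ld k a b)) (rdash : ∀ a b, p a → p b → p (rd k a b))
    (add : ∀ a b, p a → p b → p (a + b)) (smul : ∀ (r : k) a, p a → p (r • a)) (zero : p 0)
    (a : EnvelopingDialgebra k L) : p a := by
  -- Two quotients are undone: U(L) is one of F(L), which is one of the nonassociative free
  -- dialgebra.
  obtain ⟨a, rfl⟩ := Submodule.mkQ_surjective _ a
  obtain ⟨a, rfl⟩ := Submodule.mkQ_surjective _ a
  induction a using FreeDialgebra.induction with
  | gen v => exact gen v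
  | ldash a b ha hb => exact ldash _ _ ha hb
  | rdash a b ha hb => exact rdash _ _ ha hb
  | add a b ha hb => exact add _ _ ha hb
  | smul r a ha => exact smul r _ ha
  | zero => exact zero

section Lift

variable {B : Type w} [AddCommGroup B] [Module k B] [Dialgebra k B] [IsAssocDialgebra k B]

/-- The universal property of `U(L)`. -/
noncomputable def lift (f : L →ₗ[k] B)
    (hf : ∀ a b, rd k (f a) (f b) = ld k (f b) (f a) + f (br (k := k) a b)) :
    EnvelopingDialgebra k L →ₗ[k] B :=
  Submodule.liftQ _ (FreeAssocDialgebra.lift f)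
    ((FreeAssocDialgebra.isDiHom_lift f).idealSpan_le_ker (by
      rintro _ ⟨a, b, rfl⟩
      rw [map_sub, map_sub, (FreeAssocDialgebra.isDiHom_lift f).map_ld,
        (FreeAssocDialgebra.isDiHom_lift f).map_rd, FreeAssocDialgebra.lift_of,
        FreeAssocDialgebra.lift_of, FreeAssocDialgebra.lift_of, hf]
      abel))

theorem isDiHom_lift (f : L →ₗ[k] B)
    (hf : ∀ a b, rd k (f a) (f b) = ld k (f b) (f a) + f (br (k := k) a b)) :
    IsDiHom k (lift f hf) :=
  (FreeAssocDialgebra.isDiHom_lift f).liftQ _ _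

theorem lift_ι (f : L →ₗ[k] B)
    (hf : ∀ a b, rd k (f a) (f b) = ld k (f b) (f a) + f (br (k := k) a b)) (a : L) :
    lift f hf (ι k L a) = f a :=
  FreeAssocDialgebra.lift_of f a

end Lift

end EnvelopingDialgebra

/-! ### The algebra `U(L^alg)` -/

section LAlg

variable (k : Type u) [Field k] (L : Type v) [AddCommGroup L] [Module k L] [LeibnizAlgebra k L]

open LeibnizAlgebra (br)

/-- The enveloping algebra `U(L^alg)`. -/
abbrev ULAlg : Type (max u v) := EnvelopingAlgebra k (lalgBr k L)

/-- The canonical map `L → L^alg → U(L^alg)`. -/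
noncomputable def ULAlg.ι : L →ₗ[k] ULAlg k L :=
  (RingQuot.mkAlgHom k (EnvelopingRel k (lalgBr k L))).toLinearMap.comp
    ((TensorAlgebra.ι k).comp (symSpan k L).mkQ)

variable {k L}

theorem ULAlg.ι_mul_ι (a b : L) :
    ι k L a * ι k L b = ι k L (br (k := k) a b) + ι k L b * ι k L a := by
  have h := RingQuot.mkAlgHom_rel k
    (EnvelopingRel.br (k := k) (f := lalgBr k L) ((symSpan k L).mkQ a) ((symSpan k L).mkQ b))
  rw [map_add, map_mul, map_mul] at h
  exact h.symm

/-- The homomorphism of algebras `U(L^alg) → R` given by a linear map `f : L → R` with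
`f [ab] = f a f b - f b f a`. -/
noncomputable def ULAlg.lift {R : Type w} [Ring R] [Algebra k R] (f : L →ₗ[k] R)
    (hf : ∀ a b, f a * f b = f (br (k := k) a b) + f b * f a) : ULAlg k L →ₐ[k] R :=
  RingQuot.liftAlgHom k ⟨TensorAlgebra.lift k ((symSpan k L).liftQ f (by
    refine Submodule.span_le.2 ?_
    rintro _ ⟨a, b, rfl⟩
    change f _ = 0
    -- Adding the relations for (a, b) and (b, a) gives f([ab] + [ba]) = 0, so `f` factors through
    -- L^alg.
    have h1 := hf a b
    rw [hf b a, ← add_assoc, ← map_add] at h1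
    exact right_eq_add.1 h1)), by
      rintro _ _ ⟨x, y⟩
      obtain ⟨a, rfl⟩ := (symSpan k L).mkQ_surjective x
      obtain ⟨b, rfl⟩ := (symSpan k L).mkQ_surjective y
      simp only [map_add, map_mul, TensorAlgebra.lift_ι_apply]
      exact (hf a b).symm⟩

theorem ULAlg.lift_ι {R : Type w} [Ring R] [Algebra k R] (f : L →ₗ[k] R)
    (hf : ∀ a b, f a * f b = f (br (k := k) a b) + f b * f a) (a : L) :
    ULAlg.lift f hf (ι k L a) = f a :=
  (RingQuot.liftAlgHom_mkAlgHom_apply _ _ _ _).trans (TensorAlgebra.lift_ι_apply _ _)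

theorem ULAlg.induction {p : ULAlg k L → Prop} (one : p 1)
    (ι_mul : ∀ a u, p u → p (ι k L a * u))
    (add : ∀ u v, p u → p v → p (u + v)) (smul : ∀ (r : k) u, p u → p (r • u))
    (u : ULAlg k L) : p u := by
  -- The claim is strengthened to arbitrary `u` satisfying `p`, so that a product `s * t` is handled
  -- by applying `t` and then `s`.
  have key : ∀ t : TensorAlgebra k (LAlg k L), ∀ u, p u →
      p (RingQuot.mkAlgHom k (EnvelopingRel k (lalgBr k L)) t * u) := by
    intro t
    induction t using TensorAlgebra.induction with
    | algebraMap r =>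
      intro u hu
      rw [AlgHom.commutes, ← Algebra.smul_def]
      exact smul r u hu
    | ι x =>
      intro u hu
      obtain ⟨a, rfl⟩ := (symSpan k L).mkQ_surjective x
      exact ι_mul a u hu
    | mul s t hs ht =>
      intro u hu
      rw [map_mul, mul_assoc]
      exact hs _ (ht _ hu)
    | add s t hs ht =>
      intro u hu
      rw [map_add, add_mul]
      exact add _ _ (hs _ hu) (ht _ hu)
  obtain ⟨t, rfl⟩ := RingQuot.mkAlgHom_surjective k (EnvelopingRel k (lalgBr k L)) u
  simpa using key t 1 one

end LAlg

/-! ### The dialgebra `L ⊗ U(L^alg)` -/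

section Tensor

variable (k : Type u) [Field k] (L : Type v) [AddCommGroup L] [Module k L] [LeibnizAlgebra k L]

open LeibnizAlgebra (br)

/-- The left action of `L` on `L ⊗ U(L^alg)` by `a (b ⊗ u) = [ab] ⊗ u + b ⊗ a u`. -/
noncomputable def leftAct : L →ₗ[k] Module.End k (L ⊗[k] ULAlg k L) :=
  (LinearMap.rTensorHom (ULAlg k L)).comp br
    + (LinearMap.lTensorHom L).comp ((LinearMap.mul k (ULAlg k L)).comp (ULAlg.ι k L))

variable {k L}

theorem leftAct_tmul (a b : L) (u : ULAlg k L) :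
    leftAct k L a (b ⊗ₜ u) = br (k := k) a b ⊗ₜ u + b ⊗ₜ (ULAlg.ι k L a * u) := rfl

/-- On the factor L this is the Leibniz identity, on U(L^alg) the commutator relation; the cross
terms [ac] ⊗ bu + [bc] ⊗ au are symmetric in a and b. -/
theorem leftAct_mul (a b : L) :
    leftAct k L a * leftAct k L b
      = leftAct k L (br (k := k) a b) + leftAct k L b * leftAct k L a := by
  refine TensorProduct.ext' fun c u => ?_
  have h : ULAlg.ι k L a * (ULAlg.ι k L b * u)
      = ULAlg.ι k L (br (k := k) a b) * u + ULAlg.ι k L b * (ULAlg.ι k L a * u) := by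
    rw [← mul_assoc, ULAlg.ι_mul_ι, add_mul, mul_assoc]
  simp only [Module.End.mul_apply, LinearMap.add_apply, leftAct_tmul, map_add, h,
    LeibnizAlgebra.leibniz (k := k) a b c, TensorProduct.add_tmul, TensorProduct.tmul_add]
  abel

variable (k L)

/-- The left action of `U(L^alg)` on `L ⊗ U(L^alg)`. -/
noncomputable def leftMul : ULAlg k L →ₐ[k] Module.End k (L ⊗[k] ULAlg k L) :=
  ULAlg.lift (leftAct k L) leftAct_mul

/-- The right action of `U(L^alg)` on `L ⊗ U(L^alg)`. -/
noncomputable def rightMul : ULAlg k L →ₗ[k] Module.End k (L ⊗[k] ULAlg k L) :=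
  (LinearMap.lTensorHom L).comp (LinearMap.mul k (ULAlg k L)).flip

/-- The map `b ⊗ u ↦ b u` from `L ⊗ U(L^alg)` to `U(L^alg)`. -/
noncomputable def tensorMul : L ⊗[k] ULAlg k L →ₗ[k] ULAlg k L :=
  TensorProduct.lift ((LinearMap.mul k (ULAlg k L)).comp (ULAlg.ι k L))

variable {k L}

theorem leftMul_ι (a : L) : leftMul k L (ULAlg.ι k L a) = leftAct k L a := ULAlg.lift_ι _ _ _

theorem rightMul_tmul (u : ULAlg k L) (b : L) (v : ULAlg k L) :
    rightMul k L u (b ⊗ₜ v) = b ⊗ₜ (v * u) := rfl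

theorem tensorMul_tmul (b : L) (u : ULAlg k L) :
    tensorMul k L (b ⊗ₜ u) = ULAlg.ι k L b * u := rfl

theorem rightMul_mul (u v : ULAlg k L) (m : L ⊗[k] ULAlg k L) :
    rightMul k L (u * v) m = rightMul k L v (rightMul k L u m) := by
  induction m using TensorProduct.induction_on with
  | zero => simp
  | tmul b w => simp [rightMul_tmul, mul_assoc]
  | add m n hm hn => simp only [map_add, hm, hn]

theorem rightMul_one (m : L ⊗[k] ULAlg k L) : rightMul k L 1 m = m := by
  induction m using TensorProduct.induction_on with
  | zero => simp
  | tmul b w => rw [rightMul_tmul, mul_one]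
  | add m n hm hn => rw [map_add, hm, hn]

theorem tensorMul_rightMul (u : ULAlg k L) (m : L ⊗[k] ULAlg k L) :
    tensorMul k L (rightMul k L u m) = tensorMul k L m * u := by
  induction m using TensorProduct.induction_on with
  | zero => simp
  | tmul b w => simp [rightMul_tmul, tensorMul_tmul, mul_assoc]
  | add m n hm hn => simp only [map_add, hm, hn, add_mul]

/-- The relation [ab] + ba = ab in U(L^alg) makes π compatible with the twisted left action. -/
theorem tensorMul_leftAct (a : L) (m : L ⊗[k] ULAlg k L) :
    tensorMul k L (leftAct k L a m) = ULAlg.ι k L a * tensorMul k L m := by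
  induction m using TensorProduct.induction_on with
  | zero => simp
  | tmul b w =>
    rw [leftAct_tmul, map_add, tensorMul_tmul, tensorMul_tmul, tensorMul_tmul, ← mul_assoc,
      ← mul_assoc, ULAlg.ι_mul_ι a b, add_mul]
  | add m n hm hn => simp only [map_add, hm, hn, mul_add]

theorem leftAct_rightMul (a : L) (v : ULAlg k L) (m : L ⊗[k] ULAlg k L) :
    leftAct k L a (rightMul k L v m) = rightMul k L v (leftAct k L a m) := by
  induction m using TensorProduct.induction_on with
  | zero => simp
  | tmul b w => simp only [rightMul_tmul, leftAct_tmul, map_add, mul_assoc]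
  | add m n hm hn => simp only [map_add, hm, hn]

theorem tensorMul_leftMul (u : ULAlg k L) (m : L ⊗[k] ULAlg k L) :
    tensorMul k L (leftMul k L u m) = u * tensorMul k L m := by
  induction u using ULAlg.induction with
  | one => simp
  | ι_mul a u hu =>
    rw [map_mul, Module.End.mul_apply, leftMul_ι, tensorMul_leftAct, hu, mul_assoc]
  | add u v hu hv => rw [map_add, LinearMap.add_apply, map_add, hu, hv, add_mul]
  | smul r u hu => rw [map_smul, LinearMap.smul_apply, map_smul, hu, smul_mul_assoc]

theorem leftMul_rightMul (u v : ULAlg k L) (m : L ⊗[k] ULAlg k L) :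
    leftMul k L u (rightMul k L v m) = rightMul k L v (leftMul k L u m) := by
  induction u using ULAlg.induction with
  | one => simp
  | ι_mul a u hu =>
    rw [map_mul, Module.End.mul_apply, leftMul_ι, hu, leftAct_rightMul, Module.End.mul_apply]
  | add u u' hu hu' =>
    rw [map_add, LinearMap.add_apply, hu, hu', LinearMap.add_apply, map_add]
  | smul r u hu => rw [map_smul, LinearMap.smul_apply, hu, LinearMap.smul_apply, map_smul]

/-- `L ⊗ U(L^alg)` is a dialgebra with `x ⊢ y = π(x) y` and `x ⊣ y = x π(y)`, where `π` is the
homomorphism of bimodules `tensorMul`. -/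
noncomputable instance tensorDialgebra : Dialgebra k (L ⊗[k] ULAlg k L) where
  ldash := ((rightMul k L).comp (tensorMul k L)).flip
  rdash := (leftMul k L).toLinearMap.comp (tensorMul k L)

theorem ld_tensor (x y : L ⊗[k] ULAlg k L) : ld k x y = rightMul k L (tensorMul k L y) x := rfl

theorem rd_tensor (x y : L ⊗[k] ULAlg k L) : rd k x y = leftMul k L (tensorMul k L x) y := rfl

/-- The bar identities hold because π(x ⊣ y) = π(x)π(y) = π(x ⊢ y); the other three say that M is a
bimodule and π respects its actions. -/
instance tensor_isAssocDialgebra : IsAssocDialgebra k (L ⊗[k] ULAlg k L) where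
  bar_right x y z := by simp only [ld_tensor, rd_tensor, tensorMul_leftMul, tensorMul_rightMul]
  bar_left x y z := by simp only [ld_tensor, rd_tensor, tensorMul_leftMul, tensorMul_rightMul]
  assoc_ll x y z := by simp only [ld_tensor, tensorMul_rightMul, rightMul_mul]
  assoc_rl x y z := by simp only [ld_tensor, rd_tensor, leftMul_rightMul]
  assoc_rr x y z := by simp only [rd_tensor, tensorMul_leftMul, map_mul, Module.End.mul_apply]

end Tensor

/-! ### The isomorphism -/

namespace EnvelopingDialgebra

variable (k : Type u) [Field k] (L : Type v) [AddCommGroup L] [Module k L] [LeibnizAlgebra k L]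

open LeibnizAlgebra (br)

/-- The homomorphism of dialgebras `U(L) → L ⊗ U(L^alg)` with `b ↦ b ⊗ 1`. -/
noncomputable def toTensor : EnvelopingDialgebra k L →ₗ[k] L ⊗[k] ULAlg k L :=
  lift ((TensorProduct.mk k L (ULAlg k L)).flip 1) (by
    -- Both sides equal [ab] ⊗ 1 + b ⊗ a.
    intro a b
    simp only [LinearMap.flip_apply, TensorProduct.mk_apply, ld_tensor, rd_tensor,
      tensorMul_tmul, mul_one, leftMul_ι, leftAct_tmul, rightMul_tmul, one_mul]
    exact add_comm _ _)

variable {k L}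

theorem isDiHom_toTensor : IsDiHom k (toTensor k L) := isDiHom_lift _ _

theorem toTensor_ι (a : L) : toTensor k L (ι k L a) = a ⊗ₜ 1 := lift_ι _ _ _

variable (k L)

/-- The right action of `U(L^alg)` on `U(L)` by `x a = x ⊣ a`. -/
noncomputable def rightAct : ULAlg k L →ₐ[k] (Module.End k (EnvelopingDialgebra k L))ᵐᵒᵖ :=
  ULAlg.lift ((MulOpposite.opLinearEquiv k).toLinearMap.comp
    ((Dialgebra.ldash (k := k) (A := EnvelopingDialgebra k L)).flip.comp (ι k L))) (by
    intro a b
    apply MulOpposite.unop_injective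
    refine LinearMap.ext fun x => ?_
    change ld k (ld k x (ι k L a)) (ι k L b)
      = ld k x (ι k L (br (k := k) a b)) + ld k (ld k x (ι k L b)) (ι k L a)
    -- The bar identity turns x ⊣ (a ⊣ b) into x ⊣ (a ⊢ b), where the defining relation of U(L)
    -- applies.
    rw [IsAssocDialgebra.assoc_ll, IsAssocDialgebra.assoc_ll, ← IsAssocDialgebra.bar_left,
      rd_ι_ι, ld_add, add_comm])

/-- The map `L ⊗ U(L^alg) → U(L)` with `b ⊗ u ↦ b u`. -/
noncomputable def ofTensor : L ⊗[k] ULAlg k L →ₗ[k] EnvelopingDialgebra k L :=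
  TensorProduct.lift
    (((MulOpposite.opLinearEquiv k).symm.toLinearMap.comp (rightAct k L).toLinearMap).flip.comp
      (ι k L))

variable {k L}

theorem ofTensor_tmul (b : L) (u : ULAlg k L) :
    ofTensor k L (b ⊗ₜ u) = (rightAct k L u).unop (ι k L b) := rfl

theorem rightAct_ι (a : L) (x : EnvelopingDialgebra k L) :
    (rightAct k L (ULAlg.ι k L a)).unop x = ld k x (ι k L a) := by
  rw [rightAct, ULAlg.lift_ι]
  rfl

theorem rightAct_mul (u v : ULAlg k L) (x : EnvelopingDialgebra k L) :
    (rightAct k L (u * v)).unop x = (rightAct k L v).unop ((rightAct k L u).unop x) := by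
  rw [map_mul]
  rfl

theorem rightAct_add (u v : ULAlg k L) (x : EnvelopingDialgebra k L) :
    (rightAct k L (u + v)).unop x = (rightAct k L u).unop x + (rightAct k L v).unop x := by
  rw [map_add]
  rfl

theorem rightAct_smul (r : k) (u : ULAlg k L) (x : EnvelopingDialgebra k L) :
    (rightAct k L (r • u)).unop x = r • (rightAct k L u).unop x := by
  rw [map_smul]
  rfl

theorem rightAct_one (x : EnvelopingDialgebra k L) : (rightAct k L 1).unop x = x := by
  rw [map_one]
  rfl

/-- Iterates (x ⊢ y) ⊣ a = x ⊢ (y ⊣ a); the induction lets y vary because the first letter of u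
replaces y by y ⊣ a. -/
theorem rd_rightAct (x y : EnvelopingDialgebra k L) (u : ULAlg k L) :
    rd k x ((rightAct k L u).unop y) = (rightAct k L u).unop (rd k x y) := by
  induction u using ULAlg.induction generalizing y with
  | one => rw [rightAct_one, rightAct_one]
  | ι_mul a u hu =>
    rw [rightAct_mul, hu, rightAct_mul, rightAct_ι, rightAct_ι, IsAssocDialgebra.assoc_rl]
  | add u v hu hv => rw [rightAct_add, rd_add, hu, hv, rightAct_add]
  | smul r u hu => rw [rightAct_smul, rd_smul, hu, rightAct_smul]

theorem toTensor_rightAct (x : EnvelopingDialgebra k L) (u : ULAlg k L) :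
    toTensor k L ((rightAct k L u).unop x) = rightMul k L u (toTensor k L x) := by
  induction u using ULAlg.induction generalizing x with
  | one => rw [rightAct_one, rightMul_one]
  | ι_mul a u hu =>
    rw [rightAct_mul, hu, rightAct_ι, isDiHom_toTensor.map_ld, rightMul_mul, ld_tensor,
      toTensor_ι, tensorMul_tmul, mul_one]
  | add u v hu hv => rw [rightAct_add, map_add, hu, hv, map_add, LinearMap.add_apply]
  | smul r u hu => rw [rightAct_smul, map_smul, hu, map_smul, LinearMap.smul_apply]

theorem toTensor_ofTensor (m : L ⊗[k] ULAlg k L) : toTensor k L (ofTensor k L m) = m := by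
  induction m using TensorProduct.induction_on with
  | zero => simp
  | tmul b u => rw [ofTensor_tmul, toTensor_rightAct, toTensor_ι, rightMul_tmul, one_mul]
  | add m n hm hn => rw [map_add, map_add, hm, hn]

/-- The operator x ↦ x ⊣ y depends only on the image of y in U(L^alg). There ⊣ and ⊢ both become the
product, which `bar_left` matches in U(L). -/
theorem rightAct_tensorMul_toTensor (x y : EnvelopingDialgebra k L) :
    (rightAct k L (tensorMul k L (toTensor k L y))).unop x = ld k x y := by
  induction y using EnvelopingDialgebra.induction generalizing x with
  | gen a => rw [toTensor_ι, tensorMul_tmul, mul_one, rightAct_ι]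
  | ldash y z hy hz =>
    rw [isDiHom_toTensor.map_ld, ld_tensor, tensorMul_rightMul, rightAct_mul, hy, hz,
      IsAssocDialgebra.assoc_ll]
  | rdash y z hy hz =>
    rw [isDiHom_toTensor.map_rd, rd_tensor, tensorMul_leftMul, rightAct_mul, hy, hz,
      IsAssocDialgebra.bar_left, IsAssocDialgebra.assoc_ll]
  | add y z hy hz => rw [map_add, map_add, rightAct_add, hy, hz, ld_add]
  | smul r y hy => rw [map_smul, map_smul, rightAct_smul, hy, ld_smul]
  | zero => rw [map_zero, map_zero, map_zero]; exact (map_zero _).symm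

theorem ofTensor_rightMul (u : ULAlg k L) (m : L ⊗[k] ULAlg k L) :
    ofTensor k L (rightMul k L u m) = (rightAct k L u).unop (ofTensor k L m) := by
  induction m using TensorProduct.induction_on with
  | zero => simp
  | tmul b v => rw [rightMul_tmul, ofTensor_tmul, rightAct_mul, ofTensor_tmul]
  | add m n hm hn => simp only [map_add, hm, hn]

/-- The left action on L ⊗ U(L^alg) is forced by this: a ⊢ (b · u) = (a ⊢ b) · u = ([ab] + b ⊣ a) ·
u. -/
theorem ofTensor_leftAct (a : L) (m : L ⊗[k] ULAlg k L) :
    ofTensor k L (leftAct k L a m) = rd k (ι k L a) (ofTensor k L m) := by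
  induction m using TensorProduct.induction_on with
  | zero => simp [rd_zero]
  | tmul b u =>
    rw [leftAct_tmul, map_add, ofTensor_tmul, ofTensor_tmul, ofTensor_tmul, rd_rightAct,
      rightAct_mul, rightAct_ι, rd_ι_ι, map_add, add_comm]
  | add m n hm hn => simp only [map_add, hm, hn, rd_add]

/-- The left-hand counterpart of `rightAct_tensorMul_toTensor`, with `bar_right` identifying the two
products; the left action is carried over to U(L) along `ofTensor`. -/
theorem ofTensor_leftMul_tensorMul_toTensor (x : EnvelopingDialgebra k L)
    (m : L ⊗[k] ULAlg k L) :
    ofTensor k L (leftMul k L (tensorMul k L (toTensor k L x)) m) = rd k x (ofTensor k L m) := by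
  induction x using EnvelopingDialgebra.induction generalizing m with
  | gen a => rw [toTensor_ι, tensorMul_tmul, mul_one, leftMul_ι, ofTensor_leftAct]
  | ldash x y hx hy =>
    rw [isDiHom_toTensor.map_ld, ld_tensor, tensorMul_rightMul, map_mul, Module.End.mul_apply,
      hx, hy, IsAssocDialgebra.bar_right, IsAssocDialgebra.assoc_rr]
  | rdash x y hx hy =>
    rw [isDiHom_toTensor.map_rd, rd_tensor, tensorMul_leftMul, map_mul, Module.End.mul_apply,
      hx, hy, IsAssocDialgebra.assoc_rr]
  | add x y hx hy =>
    rw [map_add, map_add, map_add, LinearMap.add_apply, map_add, hx, hy, add_rd]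
  | smul r x hx =>
    rw [map_smul, map_smul, map_smul, LinearMap.smul_apply, map_smul, hx, smul_rd]
  | zero =>
    rw [map_zero, map_zero, map_zero, LinearMap.zero_apply, map_zero]
    exact (LinearMap.map_zero₂ _ _).symm

theorem ofTensor_toTensor (x : EnvelopingDialgebra k L) : ofTensor k L (toTensor k L x) = x := by
  induction x using EnvelopingDialgebra.induction with
  | gen a => rw [toTensor_ι, ofTensor_tmul, rightAct_one]
  | ldash x y hx hy =>
    -- The factor on the bar side acts through U(L^alg), so the claim for the other factor is
    -- enough.
    rw [isDiHom_toTensor.map_ld, ld_tensor, ofTensor_rightMul, rightAct_tensorMul_toTensor, hx]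
  | rdash x y hx hy =>
    rw [isDiHom_toTensor.map_rd, rd_tensor, ofTensor_leftMul_tensorMul_toTensor, hy]
  | add x y hx hy => rw [map_add, map_add, hx, hy]
  | smul r x hx => rw [map_smul, map_smul, hx]
  | zero => rw [map_zero, map_zero]

variable (k L) in
/-- The linear isomorphism `U(L) ≃ L ⊗ U(L^alg)`. -/
noncomputable def equivTensor : EnvelopingDialgebra k L ≃ₗ[k] L ⊗[k] ULAlg k L :=
  LinearEquiv.ofLinearMap (toTensor k L) (ofTensor k L) (LinearMap.ext toTensor_ofTensor)
    (LinearMap.ext ofTensor_toTensor)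

end EnvelopingDialgebra

end LeibnizPBW

theorem corollary8 (k : Type*) [Field k] (L : Type*) [AddCommGroup L] [Module k L]
    [LeibnizPBW.LeibnizAlgebra k L] :
    Nonempty (LeibnizPBW.EnvelopingDialgebra k L ≃ₗ[k]
      L ⊗[k] LeibnizPBW.EnvelopingAlgebra k (LeibnizPBW.lalgBr k L)) :=
  ⟨LeibnizPBW.EnvelopingDialgebra.equivTensor k L⟩
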